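/- Let $G$ be a five-dimensional Lie group with a left invariant Riemannian metric $\tilde a$, and let $E_1,\dots,E_5$ be an orthonormal basis of its Lie algebra whose only non-zero brackets (up to skew-symmetry) are $$[E_1,E_2]=kE_3+lE_4+mE_5,\qquad [E_1,E_3]=pE_4,\qquad [E_2,E_3]=qE_5,$$ where either $k>0$, $q>p>0$, $l,m\ge 0$, or $k,p>0$, $l\ge 0$, $m=0$, $q=p$ (the Lie algebra $\mathfrak l_{5,9}$). Let $X$ be a left invariant vector field with $\tilde a(X,X)<1$, and suppose that the left invariant Randers metric $$F(x,y)=\sqrt{\tilde a(y,y)}+\tilde a(X(x),y)$$ is of Douglas type, that is, in every local coordinate system its spray coefficients $G^i=\frac14 g^{ij}\big([F^2]_{x^sy^j}y^s-[F^2]_{x^j}\big)$, where $g_{ij}=\frac12[F^2]_{y^iy^j}$, have the form $G^i=\frac12\Gamma^i_{jr}(x)y^jy^r+P(x,y)y^i$ with $P$ positively homogeneous of degree one in $y$. A non-zero vector $Y$ of the Lie algebra is a geodesic vector of $(G,F)$ if $t\mapsto\exp(tY)$ is a geodesic of $F$, that is, if its local expression $c$ satisfies $\ddot c^i+2G^i(c,\dot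 c)=0$. Then a non-zero vector $Y=y_1E_1+y_2E_2+y_3E_3+y_4E_4+y_5E_5$ is a geodesic vector of $(G,F)$ if and only if at least one of the following holds: 1. $Y\in\mathrm{span}\{E_3\}$; 2. $Y\in\mathrm{span}\{E_4,E_5\}$; 3. $Y\in\mathrm{span}\{E_2,E_3,E_4\}$ and $y_2(ky_3+ly_4)+py_3y_4=0$; 4. $Y$ is not orthogonal to $E_1$, and $$y_1(ky_3+ly_4+my_5)-qy_3y_5=0,\qquad p\,y_1y_4+q\,y_2y_5=0.$$ -/

import Mathlib

open scoped Manifold ContDiff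

noncomputable section

namespace LieFinsler

/-! ### Finsler geometry in local coordinates -/

/-- The `i`-th coordinate vector of `ℝⁿ`. -/
def coordVec {n : ℕ} (i : Fin n) : EuclideanSpace ℝ (Fin n) := EuclideanSpace.single i 1

/-- `∂L/∂xⁱ` of a function `L (x, y)`. -/
def partialX {n : ℕ} (i : Fin n)
    (L : EuclideanSpace ℝ (Fin n) → EuclideanSpace ℝ (Fin n) → ℝ)
    (x y : EuclideanSpace ℝ (Fin n)) : ℝ :=
  fderiv ℝ (fun x' => L x' y) x (coordVec i)

/-- `∂L/∂yⁱ` of a function `L (x, y)`. -/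
def partialY {n : ℕ} (i : Fin n)
    (L : EuclideanSpace ℝ (Fin n) → EuclideanSpace ℝ (Fin n) → ℝ)
    (x y : EuclideanSpace ℝ (Fin n)) : ℝ :=
  fderiv ℝ (fun y' => L x y') y (coordVec i)

/-- The matrix `g_{ij}(x, y) = ½ ∂²L / ∂yⁱ∂yʲ`, where `L = F²`. -/
def fundamentalTensor {n : ℕ}
    (L : EuclideanSpace ℝ (Fin n) → EuclideanSpace ℝ (Fin n) → ℝ)
    (x y : EuclideanSpace ℝ (Fin n)) : Matrix (Fin n) (Fin n) ℝ :=
  Matrix.of fun i j => (1 / 2) * partialY i (partialY j L) x y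

/-- The spray coefficients `Gⁱ = ¼ g^{il} ([L]_{x^m y^l} y^m - [L]_{x^l})`, where `L = F²`. -/
def sprayCoeff {n : ℕ}
    (L : EuclideanSpace ℝ (Fin n) → EuclideanSpace ℝ (Fin n) → ℝ)
    (x y : EuclideanSpace ℝ (Fin n)) (i : Fin n) : ℝ :=
  (1 / 4) * ∑ l, (fundamentalTensor L x y)⁻¹ i l *
    ((∑ m, partialX m (partialY l L) x y * y m) - partialX l L x y)

section Manifold

variable {n : ℕ} {M : Type*} [TopologicalSpace M] [ChartedSpace (EuclideanSpace ℝ (Fin n)) M]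

/-- The function `F²` on `TM` read in the standard coordinates `(x, y)` of `TM` which come from a
chart `φ` of `M`; it is meaningful for `x ∈ φ.target`. -/
def localSq (F : ∀ p : M, TangentSpace (𝓡 n) p → ℝ)
    (φ : OpenPartialHomeomorph M (EuclideanSpace ℝ (Fin n)))
    (x y : EuclideanSpace ℝ (Fin n)) : ℝ :=
  (F (φ.symm x) (mfderiv (𝓡 n) (𝓡 n) φ.symm x y)) ^ 2

/-- `F` is of Douglas type: in every chart of the smooth structure,
`Gⁱ(x, y) = ½ Γⁱⱼₖ(x) yʲ yᵏ + P(x, y) yⁱ` with `P` positively homogeneous of degree one in `y`. -/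
def IsDouglas (F : ∀ p : M, TangentSpace (𝓡 n) p → ℝ) : Prop :=
  ∀ φ ∈ IsManifold.maximalAtlas (𝓡 n) ∞ M,
    ∃ (Γ : EuclideanSpace ℝ (Fin n) → Fin n → Fin n → Fin n → ℝ)
      (P : EuclideanSpace ℝ (Fin n) → EuclideanSpace ℝ (Fin n) → ℝ),
      (∀ x ∈ φ.target, ∀ y, y ≠ 0 → ∀ c : ℝ, 0 < c → P x (c • y) = c * P x y) ∧
      ∀ x ∈ φ.target, ∀ y, y ≠ 0 → ∀ i,
        sprayCoeff (localSq F φ) x y i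
          = (1 / 2) * (∑ j, ∑ k, Γ x i j k * y j * y k) + P x y * y i

/-- The coordinates of the curve `γ` in the chart `φ`. -/
def coordCurve (φ : OpenPartialHomeomorph M (EuclideanSpace ℝ (Fin n))) (γ : ℝ → M) (t : ℝ) :
    EuclideanSpace ℝ (Fin n) := φ (γ t)

/-- `γ` is a (constant speed) geodesic of `F`: a smooth curve with nowhere vanishing velocity such
that `c''ⁱ + 2 Gⁱ(c, c') = 0` for its expression `c` in every chart. -/
def IsGeodesic (F : ∀ p : M, TangentSpace (𝓡 n) p → ℝ) (γ : ℝ → M) : Prop :=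
  ContMDiff 𝓘(ℝ, ℝ) (𝓡 n) ∞ γ ∧
  ∀ φ ∈ IsManifold.maximalAtlas (𝓡 n) ∞ M, ∀ t : ℝ, γ t ∈ φ.source →
    deriv (coordCurve φ γ) t ≠ 0 ∧
    ∀ i, deriv (deriv (coordCurve φ γ)) t i
      + 2 * sprayCoeff (localSq F φ) (φ (γ t)) (deriv (coordCurve φ γ) t) i = 0

end Manifold

/-! ### Left invariant metrics on Lie groups -/

section LieGroup

variable {n : ℕ} {G : Type*} [TopologicalSpace G] [ChartedSpace (EuclideanSpace ℝ (Fin n)) G]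
  [Group G]

/-- `γ` is the one-parameter subgroup `t ↦ exp (tY)` of `G`. -/
def IsOneParameterSubgroup (Y : GroupLieAlgebra (𝓡 n) G) (γ : ℝ → G) : Prop :=
  ContMDiff 𝓘(ℝ, ℝ) (𝓡 n) ∞ γ ∧ γ 0 = 1 ∧ (∀ s t, γ (s + t) = γ s * γ t) ∧
    mfderiv 𝓘(ℝ, ℝ) (𝓡 n) γ 0 (1 : ℝ) = Y

/-- `Y` is a geodesic vector of `(G, F)`: it is nonzero and `t ↦ exp (tY)` is a geodesic. -/
def IsGeodesicVector (F : ∀ g : G, TangentSpace (𝓡 n) g → ℝ) (Y : GroupLieAlgebra (𝓡 n) G) :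
    Prop :=
  Y ≠ 0 ∧ ∃ γ : ℝ → G, IsOneParameterSubgroup Y γ ∧ IsGeodesic F γ

/-- Smooth Riemannian metrics on the manifold `G`. -/
abbrev Metric (n : ℕ) (G : Type*) [TopologicalSpace G]
    [ChartedSpace (EuclideanSpace ℝ (Fin n)) G] [IsManifold (𝓡 n) ∞ G] :=
  Bundle.ContMDiffRiemannianMetric (𝓡 n) ∞ (EuclideanSpace ℝ (Fin n))
    (fun g : G => TangentSpace (𝓡 n) g)

/-- Left translations are isometries of `a`. -/
def IsLeftInvariant [IsManifold (𝓡 n) ∞ G] (a : Metric n G) : Prop :=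
  ∀ (g h : G) (u v : TangentSpace (𝓡 n) h),
    a.inner (g * h) (mfderiv (𝓡 n) (𝓡 n) (fun x => g * x) h u)
      (mfderiv (𝓡 n) (𝓡 n) (fun x => g * x) h v) = a.inner h u v

/-- The function `F(g, y) = √(a(y, y)) + a(X(g), y)` on `TG`, where the left invariant vector
field `X` is given by its value at the identity. -/
def randers [IsManifold (𝓡 n) ∞ G] (a : Metric n G) (X : GroupLieAlgebra (𝓡 n) G)
    (g : G) (y : TangentSpace (𝓡 n) g) : ℝ :=
  Real.sqrt (a.inner g y y) + a.inner g (mulInvariantVectorField X g) y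

end LieGroup

/-- The basis `E 0, …, E 4` (which stands for `E₁, …, E₅`) satisfies the bracket relations of the
Lie algebra `𝔩₅,₉` with parameters `k, l, m, p, q`. -/
structure IsL59Basis {𝔤 : Type*} [AddCommGroup 𝔤] [Module ℝ 𝔤] [Bracket 𝔤 𝔤]
    (k l m p q : ℝ) (E : Module.Basis (Fin 5) ℝ 𝔤) : Prop where
  params : (0 < k ∧ p < q ∧ 0 < p ∧ 0 ≤ l ∧ 0 ≤ m) ∨ (0 < k ∧ 0 < p ∧ 0 ≤ l ∧ m = 0 ∧ q = p)
  b12 : ⁅E 0, E 1⁆ = k • E 2 + l • E 3 + m • E 4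
  b13 : ⁅E 0, E 2⁆ = p • E 3
  b14 : ⁅E 0, E 3⁆ = 0
  b15 : ⁅E 0, E 4⁆ = 0
  b23 : ⁅E 1, E 2⁆ = q • E 4
  b24 : ⁅E 1, E 3⁆ = 0
  b25 : ⁅E 1, E 4⁆ = 0
  b34 : ⁅E 2, E 3⁆ = 0
  b35 : ⁅E 2, E 4⁆ = 0
  b45 : ⁅E 3, E 4⁆ = 0

end LieFinsler

end

/-! Read in the left invariant coframe `A`, the metric is one fixed Minkowski norm N(u) = ‖u‖ + ⟪ξ,
u⟫, where ξ is the coordinate vector of X; only `A` varies from point to point. The spray equation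
then couples the Hessian of N² to the torsion of `A`, which by Maurer–Cartan is minus the Lie
bracket (`sprayCoeff_randers`). Along exp(tY) the velocity has constant coframe components, so the
remaining derivative of `A` cancels against the acceleration. As ‖ξ‖ < 1 makes the Hessian positive
definite, Y is a geodesic vector iff dN_Y([Y, w]) = ⟪Y, [Y, w]⟫/‖Y‖ + ⟪X, [Y, w]⟫ vanishes for all w
(`isGeodesicVector_randers_iff`).

The Douglas condition removes the second term. A spray that is quadratic in y modulo the radial
direction makes one side of the spray equation even in the velocity, while the term with ξ is odd;
hence X is orthogonal to the derived algebra (`inner_torsion_eq_zero`,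
`inner_coords_lie_eq_zero_of_isDouglas`). The geodesic vectors are therefore those of the Riemannian
metric: ⟪Y, [Y, w]⟫ = 0 for all w.

Since E₄ and E₅ are central, this amounts to three quadratic equations, from w = E₁, E₂, E₃. The
identity ⟪Y, [Y, Y]⟫ = 0 makes the first redundant when y₁ ≠ 0; when y₁ = 0 the others read y₃y₅ =
y₂y₅ = 0, and the cases follow (`geodesic_equations_iff`). -/

noncomputable section

namespace LieFinsler

open Filter Topology VectorField

/-! ### The Minkowski norm of a Randers metric -/

section Minkowski

variable {W : Type*} [NormedAddCommGroup W] [InnerProductSpace ℝ W]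

/-- The Minkowski norm `u ↦ ‖u‖ + ⟪ξ, u⟫`. -/
def randersNorm (ξ u : W) : ℝ := ‖u‖ + inner ℝ ξ u

/-- The differential of `randersNorm ξ` at `u`. -/
def randersNormDeriv (ξ u : W) : W →L[ℝ] ℝ := ‖u‖⁻¹ • innerSL ℝ u + innerSL ℝ ξ

/-- The second differential of the norm at `u`. -/
def normHess (u v w : W) : ℝ := ‖u‖⁻¹ * inner ℝ v w - ‖u‖⁻¹ ^ 3 * inner ℝ u v * inner ℝ u w

/-- The differential of `randersNorm ξ ^ 2` at `u`. -/
def randersSqDeriv (ξ u : W) : W →L[ℝ] ℝ := (2 * randersNorm ξ u) • randersNormDeriv ξ u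

lemma randersNormDeriv_apply (ξ u w : W) :
    randersNormDeriv ξ u w = ‖u‖⁻¹ * inner ℝ u w + inner ℝ ξ w := by
  simp [randersNormDeriv]

lemma randersSqDeriv_apply (ξ u w : W) :
    randersSqDeriv ξ u w = 2 * randersNorm ξ u * randersNormDeriv ξ u w := by
  simp [randersSqDeriv]

lemma hasFDerivAt_norm {u : W} (hu : u ≠ 0) :
    HasFDerivAt (fun u : W => ‖u‖) (‖u‖⁻¹ • innerSL ℝ u) u := by
  have h := (hasStrictFDerivAt_norm_sq u).hasFDerivAt.sqrt (by simpa using hu)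
  simp only [Real.sqrt_sq (norm_nonneg _)] at h
  convert h using 1
  ext w
  have : ‖u‖ ≠ 0 := by simpa using hu
  simp
  field_simp

lemma hasFDerivAt_randersNorm (ξ : W) {u : W} (hu : u ≠ 0) :
    HasFDerivAt (randersNorm ξ) (randersNormDeriv ξ u) u :=
  (hasFDerivAt_norm hu).add (innerSL ℝ ξ).hasFDerivAt

lemma hasFDerivAt_randersNorm_sq (ξ : W) {u : W} (hu : u ≠ 0) :
    HasFDerivAt (fun u => randersNorm ξ u ^ 2) (randersSqDeriv ξ u) u := by
  refine ((hasFDerivAt_randersNorm ξ hu).pow 2).congr_fderiv ?_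
  ext w
  simp [randersSqDeriv]

lemma hasFDerivAt_randersNormDeriv (ξ : W) {u : W} (hu : u ≠ 0) :
    ∃ H : W →L[ℝ] W →L[ℝ] ℝ, HasFDerivAt (randersNormDeriv ξ) H u ∧
      ∀ v w, H v w = normHess u v w := by
  have hn : ‖u‖ ≠ 0 := by simpa using hu
  have h := (((hasDerivAt_inv hn).comp_hasFDerivAt u (hasFDerivAt_norm hu)).smul
    (innerSL ℝ (E := W)).hasFDerivAt).add_const (innerSL ℝ ξ)
  refine ⟨_, h, fun v w => ?_⟩
  change ‖u‖⁻¹ * inner ℝ v w + (-(‖u‖ ^ 2)⁻¹ * (‖u‖⁻¹ * inner ℝ u v)) * inner ℝ u w = _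
  rw [normHess]
  field_simp
  ring

lemma differentiableAt_randersSqDeriv (ξ : W) {u : W} (hu : u ≠ 0) :
    DifferentiableAt ℝ (randersSqDeriv ξ) u := by
  obtain ⟨H, hH, -⟩ := hasFDerivAt_randersNormDeriv ξ hu
  exact ((hasFDerivAt_randersNorm ξ hu).differentiableAt.const_mul 2).smul hH.differentiableAt

lemma fderiv_randersSqDeriv_apply (ξ : W) {u : W} (hu : u ≠ 0) (v w : W) :
    fderiv ℝ (randersSqDeriv ξ) u v w =
      2 * (randersNormDeriv ξ u v * randersNormDeriv ξ u w
        + randersNorm ξ u * normHess u v w) := by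
  obtain ⟨H, hH, hHv⟩ := hasFDerivAt_randersNormDeriv ξ hu
  have h : HasFDerivAt (randersSqDeriv ξ) _ u :=
    ((hasFDerivAt_randersNorm ξ hu).const_mul 2).smul hH
  rw [h.fderiv]
  simp [hHv]
  ring

lemma normHess_comm (u v w : W) : normHess u v w = normHess u w v := by
  simp only [normHess, real_inner_comm v w]; ring

lemma normHess_neg_left (u v w : W) : normHess (-u) v w = normHess u v w := by
  simp [normHess]

/-- Euler's relation: the norm is homogeneous of degree one, so its Hessian kills the radial
direction. -/
lemma normHess_self_right {u : W} (hu : u ≠ 0) (v : W) : normHess u v u = 0 := by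
  have hn : ‖u‖ ≠ 0 := by simpa using hu
  simp only [normHess, real_inner_self_eq_norm_sq, real_inner_comm u v]
  field_simp
  ring

lemma normHess_add_smul_left {u : W} (hu : u ≠ 0) (v w : W) (c : ℝ) :
    normHess u (v + c • u) w = normHess u v w := by
  have h := normHess_self_right hu w
  simp only [normHess, inner_add_left, inner_add_right, inner_smul_left,
    inner_smul_right, RCLike.conj_to_real] at h ⊢
  rw [real_inner_comm] at h
  linear_combination c * h

lemma randersNormDeriv_self (ξ : W) {u : W} (hu : u ≠ 0) :
    randersNormDeriv ξ u u = randersNorm ξ u := by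
  have hn : ‖u‖ ≠ 0 := by simpa using hu
  simp only [randersNormDeriv_apply, randersNorm, real_inner_self_eq_norm_sq]
  field_simp

lemma randersNorm_pos {ξ : W} (hξ : ‖ξ‖ < 1) {u : W} (hu : u ≠ 0) : 0 < randersNorm ξ u := by
  have h1 := abs_real_inner_le_norm ξ u
  have h2 : ‖ξ‖ * ‖u‖ < 1 * ‖u‖ := by gcongr
  have := neg_abs_le (inner ℝ ξ u)
  unfold randersNorm
  linarith

/-- `normHess u v v` is ‖u‖⁻¹ times the squared length of the component of `v` orthogonal to `u`.
The hypothesis is only `≤ 0`, so that nonnegativity can be deduced from this lemma. -/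
lemma eq_smul_of_normHess_self_eq_zero {u : W} (hu : u ≠ 0) {v : W}
    (h : normHess u v v ≤ 0) : ∃ c : ℝ, v = c • u := by
  have hn : 0 < ‖u‖ := by simpa using hu
  refine ⟨inner ℝ u v / ‖u‖ ^ 2, ?_⟩
  rw [← sub_eq_zero, ← norm_eq_zero, ← sq_eq_zero_iff]
  refine le_antisymm ?_ (sq_nonneg _)
  rw [norm_sub_sq_real, inner_smul_right, norm_smul, real_inner_comm u v]
  have : normHess u v v = ‖u‖⁻¹ * (‖v‖ ^ 2 - 2 * (inner ℝ u v / ‖u‖ ^ 2 * inner ℝ u v) +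
      (‖inner ℝ u v / ‖u‖ ^ 2‖ * ‖u‖) ^ 2) := by
    rw [normHess, mul_pow, Real.norm_eq_abs, sq_abs, real_inner_self_eq_norm_sq]
    field_simp
    ring
  rw [this] at h
  exact nonpos_of_mul_nonpos_right h (by positivity)

lemma normHess_self_nonneg (u v : W) : 0 ≤ normHess u v v := by
  rcases eq_or_ne u 0 with rfl | hu
  · simp [normHess]
  by_contra! h
  obtain ⟨c, rfl⟩ := eq_smul_of_normHess_self_eq_zero hu h.le
  have h1 := normHess_add_smul_left hu 0 (c • u) c
  rw [zero_add] at h1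
  rw [h1] at h
  simp [normHess] at h

/-- Strong convexity of N²: half its Hessian is the square of dN plus N times the nonnegative
Hessian of the norm. If both vanish, `v` is radial, and on radial vectors dN is a multiple of N > 0.
-/
lemma eq_zero_of_fderiv_randersSqDeriv_self_eq_zero {ξ : W} (hξ : ‖ξ‖ < 1) {u : W} (hu : u ≠ 0)
    {v : W} (h : fderiv ℝ (randersSqDeriv ξ) u v v = 0) : v = 0 := by
  rw [fderiv_randersSqDeriv_apply ξ hu] at h
  have hN := randersNorm_pos hξ hu
  have h1 := mul_nonneg hN.le (normHess_self_nonneg u v)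
  have h2 := mul_self_nonneg (randersNormDeriv ξ u v)
  have h3 : normHess u v v ≤ 0 := by
    refine nonpos_of_mul_nonpos_right (a := randersNorm ξ u) ?_ hN
    linarith
  have h4 : randersNormDeriv ξ u v = 0 := by
    rw [← mul_self_eq_zero]; linarith
  obtain ⟨c, rfl⟩ := eq_smul_of_normHess_self_eq_zero hu h3
  rw [map_smul, randersNormDeriv_self ξ hu, smul_eq_mul, mul_eq_zero] at h4
  rcases h4 with rfl | h4
  · simp
  · exact absurd h4 hN.ne'

/-- A geodesic spray which is quadratic up to multiples of the radial direction forces the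
Randers one-form to vanish on the torsion `C`. -/
lemma inner_torsion_eq_zero {ξ : W} (hξ : ‖ξ‖ < 1) {C : W → W → W} {Q : W → W} {μ : W → ℝ}
    (hC : ∀ u, C u u = 0) (hCneg : ∀ u w, C (-u) w = -C u w) (hQ : ∀ u, Q (-u) = Q u)
    (h : ∀ u, u ≠ 0 → ∀ w,
      fderiv ℝ (randersSqDeriv ξ) u (Q u + μ u • u) w = randersSqDeriv ξ u (C u w))
    {u : W} (hu : u ≠ 0) (w : W) : inner ℝ ξ (C u w) = 0 := by
  have key : ∀ u, u ≠ 0 → normHess u (Q u) w = randersNormDeriv ξ u (C u w) := by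
    intro u hu
    have hN := randersNorm_pos hξ hu
    -- Testing in the radial direction kills the torsion and the Hessian of the norm, leaving dN(Q +
    -- μu) = 0.
    have h0 := h u hu u
    have h1 := h u hu w
    rw [fderiv_randersSqDeriv_apply ξ hu, randersSqDeriv_apply] at h0 h1
    rw [normHess_self_right hu, hC, map_zero, randersNormDeriv_self ξ hu] at h0
    have h2 : randersNormDeriv ξ u (Q u + μ u • u) = 0 := by
      have : randersNormDeriv ξ u (Q u + μ u • u) * randersNorm ξ u = 0 := by linarith
      exact (mul_eq_zero.mp this).resolve_right hN.ne'
    rw [h2, normHess_add_smul_left hu] at h1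
    refine mul_left_cancel₀ hN.ne' ?_
    linarith
  -- Compare u with -u: the Hessian side and ‖u‖⁻¹⟪u, C u w⟫ are even, whereas ⟪ξ, C u w⟫ is odd and
  -- must vanish.
  have h1 := key u hu
  have h2 := key (-u) (neg_ne_zero.mpr hu)
  rw [normHess_neg_left, hQ, hCneg] at h2
  simp only [randersNormDeriv_apply, norm_neg, inner_neg_left, inner_neg_right] at h1 h2
  linarith

end Minkowski

/-! ### The spray of a Randers metric in a moving frame -/

section Frame

variable {n : ℕ} {ξ x y : EuclideanSpace ℝ (Fin n)}
  {L : EuclideanSpace ℝ (Fin n) → EuclideanSpace ℝ (Fin n) → ℝ}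
  {A : EuclideanSpace ℝ (Fin n) → EuclideanSpace ℝ (Fin n) →L[ℝ] EuclideanSpace ℝ (Fin n)}

lemma sum_smul_coordVec (v : EuclideanSpace ℝ (Fin n)) : ∑ i, v i • coordVec i = v := by
  simpa [coordVec] using (EuclideanSpace.basisFun (Fin n) ℝ).sum_repr v

lemma map_eq_sum_coordVec {W : Type*} [AddCommGroup W] [Module ℝ W] [TopologicalSpace W]
    (T : EuclideanSpace ℝ (Fin n) →L[ℝ] W)
    (v : EuclideanSpace ℝ (Fin n)) : T v = ∑ i, v i • T (coordVec i) := by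
  conv_lhs => rw [← sum_smul_coordVec v]
  simp

lemma partialY_of_frame (hL : ∀ y, L x y = randersNorm ξ (A x y) ^ 2) (hy : A x y ≠ 0)
    (i : Fin n) : partialY i L x y = randersSqDeriv ξ (A x y) (A x (coordVec i)) := by
  simp only [partialY, hL]
  have h := (hasFDerivAt_randersNorm_sq ξ hy).comp y (A x).hasFDerivAt
  erw [h.fderiv]
  rfl

lemma fderiv_randersSqDeriv_apply_apply
    {P Q : EuclideanSpace ℝ (Fin n) → EuclideanSpace ℝ (Fin n)}
    {P' Q' : EuclideanSpace ℝ (Fin n) →L[ℝ] EuclideanSpace ℝ (Fin n)}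
    (hP : HasFDerivAt P P' x) (hQ : HasFDerivAt Q Q' x) (hx : P x ≠ 0)
    (v : EuclideanSpace ℝ (Fin n)) :
    fderiv ℝ (fun z => randersSqDeriv ξ (P z) (Q z)) x v =
      fderiv ℝ (randersSqDeriv ξ) (P x) (P' v) (Q x) + randersSqDeriv ξ (P x) (Q' v) := by
  have h := ((differentiableAt_randersSqDeriv ξ hx).hasFDerivAt.comp x hP).clm_apply hQ
  simp only [Function.comp_apply] at h
  rw [h.fderiv]
  simp [add_comm]

lemma partialY_partialY_of_frame (hL : ∀ y, L x y = randersNorm ξ (A x y) ^ 2) (hy : A x y ≠ 0)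
    (i j : Fin n) : partialY i (partialY j L) x y =
      fderiv ℝ (randersSqDeriv ξ) (A x y) (A x (coordVec i)) (A x (coordVec j)) := by
  -- The formula for the first derivative needs `A x y' ≠ 0`, which is an open condition around `y`.
  have h : (fun y' => partialY j L x y') =ᶠ[𝓝 y]
      fun y' => randersSqDeriv ξ (A x y') (A x (coordVec j)) := by
    filter_upwards [(A x).continuous.continuousAt.eventually_ne hy] with y' hy'
    exact partialY_of_frame hL hy' j
  rw [partialY, h.fderiv_eq,
    fderiv_randersSqDeriv_apply_apply (A x).hasFDerivAt (hasFDerivAt_const _ _) hy]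
  simp

lemma partialX_of_frame (hL : ∀ᶠ z in 𝓝 x, ∀ y, L z y = randersNorm ξ (A z y) ^ 2)
    (hA : DifferentiableAt ℝ A x) (hy : A x y ≠ 0) (i : Fin n) :
    partialX i L x y = randersSqDeriv ξ (A x y) (fderiv ℝ A x (coordVec i) y) := by
  have h : (fun z => L z y) =ᶠ[𝓝 x] fun z => randersNorm ξ (A z y) ^ 2 := by
    filter_upwards [hL] with z hz using hz y
  have h2 := (hasFDerivAt_randersNorm_sq ξ hy).comp x
    (hA.hasFDerivAt.clm_apply (hasFDerivAt_const y x))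
  rw [partialX, h.fderiv_eq]
  erw [h2.fderiv]
  simp

lemma partialX_partialY_of_frame (hL : ∀ᶠ z in 𝓝 x, ∀ y, L z y = randersNorm ξ (A z y) ^ 2)
    (hA : DifferentiableAt ℝ A x) (hy : A x y ≠ 0) (i j : Fin n) :
    partialX i (partialY j L) x y =
      fderiv ℝ (randersSqDeriv ξ) (A x y) (fderiv ℝ A x (coordVec i) y) (A x (coordVec j))
        + randersSqDeriv ξ (A x y) (fderiv ℝ A x (coordVec i) (coordVec j)) := by
  have hd := fun w => hA.hasFDerivAt.clm_apply (hasFDerivAt_const w x)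
  have h : (fun z => partialY j L z y) =ᶠ[𝓝 x]
      fun z => randersSqDeriv ξ (A z y) (A z (coordVec j)) := by
    filter_upwards [hL, (hd y).continuousAt.eventually_ne hy] with z hz hz'
    exact partialY_of_frame hz hz' j
  rw [partialX, h.fderiv_eq, fderiv_randersSqDeriv_apply_apply (hd y) (hd _) hy]
  simp

/-- A kernel vector `w` of the fundamental tensor would make the positive definite Hessian vanish on
`A x w`. -/
lemma isUnit_det_fundamentalTensor_of_frame (hξ : ‖ξ‖ < 1)
    (hL : ∀ y, L x y = randersNorm ξ (A x y) ^ 2) (hinj : Function.Injective (A x))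
    (hy : A x y ≠ 0) : IsUnit (fundamentalTensor L x y).det := by
  rw [isUnit_iff_ne_zero]
  intro h0
  obtain ⟨v, hv, hv0⟩ := Matrix.exists_mulVec_eq_zero_iff.mpr h0
  set w : EuclideanSpace ℝ (Fin n) := WithLp.toLp 2 v
  have h1 : fderiv ℝ (randersSqDeriv ξ) (A x y) (A x w) (A x w) = 0 := by
    have h2 : ∀ i, fderiv ℝ (randersSqDeriv ξ) (A x y) (A x (coordVec i)) (A x w) = 0 := by
      intro i
      have := congrFun hv0 i
      simp only [Matrix.mulVec, dotProduct, fundamentalTensor, Matrix.of_apply,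
        partialY_partialY_of_frame hL hy, Pi.zero_apply] at this
      rw [map_eq_sum_coordVec (A x) w, map_sum]
      simp only [map_smul, smul_eq_mul]
      rw [← mul_right_injective₀ (one_half_pos (α := ℝ)).ne' |>.eq_iff, mul_zero, ← this,
        Finset.mul_sum]
      refine Finset.sum_congr rfl fun j _ => ?_
      change _ * (v j * _) = _
      ring
    have h3 := map_eq_sum_coordVec
      (((fderiv ℝ (randersSqDeriv ξ) (A x y)).flip (A x w)).comp (A x)) w
    simpa [h2] using h3
  have h3 := eq_zero_of_fderiv_randersSqDeriv_self_eq_zero hξ hy h1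
  have h4 : w = 0 := hinj (by simpa using h3)
  exact hv (by simpa [w] using congrArg WithLp.ofLp h4)

lemma fundamentalTensor_mulVec_sprayCoeff (h : IsUnit (fundamentalTensor L x y).det) (i : Fin n) :
    (∑ j, fundamentalTensor L x y i j * (4 * sprayCoeff L x y j)) =
      (∑ m, partialX m (partialY i L) x y * y m) - partialX i L x y := by
  set R : Fin n → ℝ := fun l => (∑ m, partialX m (partialY l L) x y * y m) - partialX l L x y
  have hG : (fun j => 4 * sprayCoeff L x y j) = (fundamentalTensor L x y)⁻¹.mulVec R := by
    ext j
    simp only [sprayCoeff, Matrix.mulVec, dotProduct, R]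
    ring
  have : ((fundamentalTensor L x y).mulVec (fun j => 4 * sprayCoeff L x y j)) i = R i := by
    rw [hG, Matrix.mulVec_mulVec, Matrix.mul_nonsing_inv _ h, Matrix.one_mulVec]
  exact this

/-- The spray of the Randers metric whose coframe is `A` is characterized by the torsion of `A`. -/
lemma sprayCoeff_of_frame (hξ : ‖ξ‖ < 1)
    (hL : ∀ᶠ z in 𝓝 x, ∀ y, L z y = randersNorm ξ (A z y) ^ 2)
    (hA : DifferentiableAt ℝ A x) (hinj : Function.Injective (A x)) (hy : y ≠ 0)
    (w : EuclideanSpace ℝ (Fin n)) :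
    fderiv ℝ (randersSqDeriv ξ) (A x y)
        (A x ((2 : ℝ) • WithLp.toLp 2 (sprayCoeff L x y)) - fderiv ℝ A x y y) (A x w) =
      randersSqDeriv ξ (A x y) (fderiv ℝ A x y w - fderiv ℝ A x w y) := by
  have hy' : A x y ≠ 0 := by simpa using hinj.ne hy
  set D := fderiv ℝ (randersSqDeriv ξ) (A x y)
  set S := randersSqDeriv ξ (A x y)
  have hsymm : ∀ v w, D v w = D w v := fun v w => by
    rw [fderiv_randersSqDeriv_apply ξ hy', fderiv_randersSqDeriv_apply ξ hy', normHess_comm]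
    ring
  -- The factor ½ in the fundamental tensor and the 4 from the spray combine to 2G. The mixed
  -- derivative contributes the Hessian term in dA(y)y, and the two remaining first-order terms form
  -- the torsion.
  have key : ∀ i, D (A x ((2 : ℝ) • WithLp.toLp 2 (sprayCoeff L x y)) - fderiv ℝ A x y y)
        (A x (coordVec i)) =
      S (fderiv ℝ A x y (coordVec i) - fderiv ℝ A x (coordVec i) y) := by
    intro i
    have h := fundamentalTensor_mulVec_sprayCoeff
      (isUnit_det_fundamentalTensor_of_frame hξ hL.self_of_nhds hinj hy') i
    simp only [fundamentalTensor, Matrix.of_apply, partialX_partialY_of_frame hL hA hy',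
      partialX_of_frame hL hA hy', partialY_partialY_of_frame hL.self_of_nhds hy'] at h
    have h1 : D (A x ((2 : ℝ) • WithLp.toLp 2 (sprayCoeff L x y))) (A x (coordVec i)) =
        ∑ j, 1 / 2 * D (A x (coordVec i)) (A x (coordVec j)) * (4 * sprayCoeff L x y j) := by
      rw [hsymm]
      refine (map_eq_sum_coordVec ((D (A x (coordVec i))).comp (A x)) _).trans ?_
      refine Finset.sum_congr rfl fun j _ => ?_
      simp
      ring
    have h2 : ∑ m, (D (fderiv ℝ A x (coordVec m) y) (A x (coordVec i)) +
        S (fderiv ℝ A x (coordVec m) (coordVec i))) * y m =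
        D (fderiv ℝ A x y y) (A x (coordVec i)) + S (fderiv ℝ A x y (coordVec i)) := by
      have e : fderiv ℝ A x y = ∑ m, y m • fderiv ℝ A x (coordVec m) :=
        map_eq_sum_coordVec (fderiv ℝ A x) y
      simp only [e, sum_apply, smul_apply, map_sum,
        map_smul, smul_eq_mul, ← Finset.sum_add_distrib]
      exact Finset.sum_congr rfl fun j _ => by ring
    rw [map_sub, sub_apply, h1, h, h2, map_sub]
    ring
  set Z := A x ((2 : ℝ) • WithLp.toLp 2 (sprayCoeff L x y)) - fderiv ℝ A x y y
  have h1 := map_eq_sum_coordVec ((D Z).comp (A x)) w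
  have h2 := map_eq_sum_coordVec (S.comp (fderiv ℝ A x y - (fderiv ℝ A x).flip y)) w
  simp only [ContinuousLinearMap.comp_apply, sub_apply, ContinuousLinearMap.flip_apply, key]
    at h1 h2
  rw [h1, h2]

end Frame

lemma natCast_le_infty (k : ℕ) : (k : ℕ∞ω) ≤ ∞ := by exact_mod_cast le_top

/-! ### Charts as diffeomorphisms. -/

section Chart

variable {n : ℕ} {M : Type*} [TopologicalSpace M] [ChartedSpace (EuclideanSpace ℝ (Fin n)) M]
  {φ : OpenPartialHomeomorph M (EuclideanSpace ℝ (Fin n))}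

lemma mdifferentiable_of_mem_maximalAtlas (hφ : φ ∈ IsManifold.maximalAtlas (𝓡 n) ∞ M) :
    φ.MDifferentiable (𝓡 n) (𝓡 n) :=
  ⟨(contMDiffOn_of_mem_maximalAtlas hφ).mdifferentiableOn (by simp),
    (contMDiffOn_symm_of_mem_maximalAtlas hφ).mdifferentiableOn (by simp)⟩

lemma isInvertible_mfderiv_symm (hφ : φ ∈ IsManifold.maximalAtlas (𝓡 n) ∞ M)
    {x : EuclideanSpace ℝ (Fin n)} (hx : x ∈ φ.target) :
    (mfderiv (𝓡 n) (𝓡 n) φ.symm x).IsInvertible :=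
  ⟨(mdifferentiable_of_mem_maximalAtlas hφ).symm.mfderiv hx, rfl⟩

end Chart

/-! ### Left invariant vector fields in a chart. -/

section LieGroup

variable {n : ℕ} {G : Type*} [TopologicalSpace G] [ChartedSpace (EuclideanSpace ℝ (Fin n)) G]
  [Group G]

/-- The coordinate expression in the chart `φ` of the left invariant vector field with value `v`
at the identity. -/
def chartField (φ : OpenPartialHomeomorph G (EuclideanSpace ℝ (Fin n)))
    (v : GroupLieAlgebra (𝓡 n) G) (x : EuclideanSpace ℝ (Fin n)) : EuclideanSpace ℝ (Fin n) :=
  mpullback (𝓡 n) (𝓡 n) φ.symm (mulInvariantVectorField v) x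

lemma chartField_add (φ : OpenPartialHomeomorph G (EuclideanSpace ℝ (Fin n)))
    (v w : GroupLieAlgebra (𝓡 n) G) : chartField φ (v + w) = chartField φ v + chartField φ w := by
  ext1 x
  simp only [chartField, mulInvariantVectorField_add, mpullback_add]
  rfl

lemma chartField_smul (φ : OpenPartialHomeomorph G (EuclideanSpace ℝ (Fin n))) (c : ℝ)
    (v : GroupLieAlgebra (𝓡 n) G) : chartField φ (c • v) = c • chartField φ v := by
  ext1 x
  simp only [chartField, mulInvariantVectorField_smul, mpullback_const_smul]
  rfl

lemma mfderiv_symm_chartField {φ : OpenPartialHomeomorph G (EuclideanSpace ℝ (Fin n))}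
    {x : EuclideanSpace ℝ (Fin n)} (hφ : φ ∈ IsManifold.maximalAtlas (𝓡 n) ∞ G)
    (hx : x ∈ φ.target) (v : GroupLieAlgebra (𝓡 n) G) :
    mfderiv (𝓡 n) (𝓡 n) φ.symm x (chartField φ v x) = mulInvariantVectorField v (φ.symm x) := by
  have h := (isInvertible_mfderiv_symm hφ hx).self_comp_inverse
  exact congrArg (fun T => T (mulInvariantVectorField v (φ.symm x))) h

variable [LieGroup (𝓡 n) ∞ G]

-- This is the regularity under which the Lie ring structure on `GroupLieAlgebra` is available.
variable (n G) in
lemma lieGroup_minSmoothness_three : LieGroup (𝓡 n) (minSmoothness ℝ 3) G :=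
  LieGroup.of_le (n := ∞) (by
    rw [minSmoothness_of_isRCLikeNormedField]; exact natCast_le_infty 3)

variable (n G) in
lemma isManifold_of_lieGroup (k : ℕ) : IsManifold (𝓡 n) k G :=
  IsManifold.of_le (n := ∞) (natCast_le_infty k)

/-- The field at g is the tangent map of multiplication applied to the pair (0 at g, v at 1), a
composition of smooth maps. -/
theorem contMDiff_infty_mulInvariantVectorField (v : GroupLieAlgebra (𝓡 n) G) :
    ContMDiff (𝓡 n) (𝓡 n).tangent ∞
      (fun g : G => (⟨g, mulInvariantVectorField v g⟩ : TangentBundle (𝓡 n) G)) := by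
  let fg : G → TangentBundle (𝓡 n) G := fun g => ⟨g, 0⟩
  have sfg : ContMDiff (𝓡 n) (𝓡 n).tangent ∞ fg := Bundle.contMDiff_zeroSection _ _
  let fv : G → TangentBundle (𝓡 n) G := fun _ => ⟨1, v⟩
  have sfv : ContMDiff (𝓡 n) (𝓡 n).tangent ∞ fv := contMDiff_const
  let F₁ : G → (TangentBundle (𝓡 n) G × TangentBundle (𝓡 n) G) := fun g => (fg g, fv g)
  have S₁ : ContMDiff (𝓡 n) ((𝓡 n).tangent.prod (𝓡 n).tangent) ∞ F₁ := sfg.prodMk sfv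
  let F₂ : (TangentBundle (𝓡 n) G × TangentBundle (𝓡 n) G) →
      TangentBundle ((𝓡 n).prod (𝓡 n)) (G × G) := (equivTangentBundleProd (𝓡 n) G (𝓡 n) G).symm
  have S₂ : ContMDiff ((𝓡 n).tangent.prod (𝓡 n).tangent) ((𝓡 n).prod (𝓡 n)).tangent ∞ F₂ :=
    contMDiff_equivTangentBundleProd_symm
  let F₃ : TangentBundle ((𝓡 n).prod (𝓡 n)) (G × G) → TangentBundle (𝓡 n) G :=
    tangentMap ((𝓡 n).prod (𝓡 n)) (𝓡 n) (fun (p : G × G) => p.1 * p.2)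
  have S₃ : ContMDiff ((𝓡 n).prod (𝓡 n)).tangent (𝓡 n).tangent ∞ F₃ :=
    ContMDiff.contMDiff_tangentMap (n := ∞) (m := ∞) (contMDiff_mul (𝓡 n) ∞) (by simp)
  let S := (S₃.comp S₂).comp S₁
  convert! S with g
  · simp [F₁, F₂, F₃, fg, fv]
  · simp only [Function.comp_apply, tangentMap, F₃, F₂, F₁, fg, fv]
    rw [mfderiv_prod_eq_add_apply ((contMDiff_mul (𝓡 n) ∞).mdifferentiableAt (by simp))]
    change mfderiv (𝓡 n) (𝓡 n) (fun x : G => g * x) 1 v =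
      mfderiv (𝓡 n) (𝓡 n) (fun x : G => x * 1) g 0 +
        mfderiv (𝓡 n) (𝓡 n) (fun x : G => g * x) 1 v
    rw [map_zero]
    exact (zero_add _).symm

variable {φ : OpenPartialHomeomorph G (EuclideanSpace ℝ (Fin n))}
  {x : EuclideanSpace ℝ (Fin n)}

lemma contDiffOn_chartField (hφ : φ ∈ IsManifold.maximalAtlas (𝓡 n) ∞ G)
    (v : GroupLieAlgebra (𝓡 n) G) : ContDiffOn ℝ ∞ (chartField φ v) φ.target := by
  have := isManifold_of_lieGroup n G 1
  intro x hx
  refine ContDiffAt.contDiffWithinAt ?_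
  refine contMDiffAt_vectorSpace_iff_contDiffAt.mp ?_
  exact ContMDiffAt.mpullback_vectorField_preimage (n := ∞)
    (contMDiff_infty_mulInvariantVectorField v).contMDiffAt
    (contMDiffAt_symm_of_mem_maximalAtlas hφ hx) (isInvertible_mfderiv_symm hφ hx) (by simp)

lemma differentiableAt_chartField (hφ : φ ∈ IsManifold.maximalAtlas (𝓡 n) ∞ G)
    (hx : x ∈ φ.target) (v : GroupLieAlgebra (𝓡 n) G) :
    DifferentiableAt ℝ (chartField φ v) x :=
  ((contDiffOn_chartField hφ v).contDiffAt (φ.open_target.mem_nhds hx)).differentiableAt (by simp)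

/-- Pullback commutes with the Lie bracket, and the bracket of left invariant fields is the left
invariant field of the bracket. -/
lemma lieBracket_chartField (hφ : φ ∈ IsManifold.maximalAtlas (𝓡 n) ∞ G)
    (hx : x ∈ φ.target) (v w : GroupLieAlgebra (𝓡 n) G) :
    fderiv ℝ (chartField φ w) x (chartField φ v x) -
      fderiv ℝ (chartField φ v) x (chartField φ w x) = chartField φ ⁅v, w⁆ x := by
  have := lieGroup_minSmoothness_three n G
  have : IsManifold (𝓡 n) (minSmoothness ℝ 2) G := by
    rw [minSmoothness_of_isRCLikeNormedField]
    exact isManifold_of_lieGroup n G 2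
  have h := mpullback_mlieBracket (n := ∞) (x₀ := x) (f := φ.symm)
    (mdifferentiableAt_mulInvariantVectorField v) (mdifferentiableAt_mulInvariantVectorField w)
    (contMDiffAt_symm_of_mem_maximalAtlas hφ hx)
    (by rw [minSmoothness_of_isRCLikeNormedField]; exact natCast_le_infty 2)
  rw [← mulInvariantVector_mlieBracket, ← GroupLieAlgebra.bracket_def] at h
  rw [← mlieBracketWithin_univ, mlieBracketWithin_eq_lieBracketWithin] at h
  refine Eq.trans ?_ h.symm
  exact (congrFun (lieBracketWithin_univ (𝕜 := ℝ) (V := chartField φ v) (W := chartField φ w))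
    x).symm

lemma mdifferentiableAt_mul_left (g h : G) :
    MDifferentiableAt (𝓡 n) (𝓡 n) (fun x : G => g * x) h :=
  (contMDiff_mul_left (n := ∞)).contMDiffAt.mdifferentiableAt (by simp)

lemma mulInvariantVectorField_injective (g : G) :
    Function.Injective fun v : GroupLieAlgebra (𝓡 n) G => mulInvariantVectorField v g := by
  have hc : (mfderiv (𝓡 n) (𝓡 n) (fun x : G => g⁻¹ * x) (g * 1)).comp
      (mfderiv (𝓡 n) (𝓡 n) (fun x : G => g * x) 1) = ContinuousLinearMap.id _ _ := by
    rw [← mfderiv_comp 1 (mdifferentiableAt_mul_left _ _) (mdifferentiableAt_mul_left _ _)]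
    have : (fun x : G => g⁻¹ * x) ∘ (fun x : G => g * x) = id := by ext x; simp
    rw [this, mfderiv_id]
  intro v w hvw
  have h : ∀ u, mfderiv (𝓡 n) (𝓡 n) (fun x : G => g⁻¹ * x) (g * 1)
      (mfderiv (𝓡 n) (𝓡 n) (fun x : G => g * x) 1 u) = u := fun u => congrArg (fun T => T u) hc
  rw [← h v, ← h w]
  exact congrArg _ hvw

lemma inner_mulInvariantVectorField {a : Metric n G} (ha : IsLeftInvariant a) (g : G)
    (v w : GroupLieAlgebra (𝓡 n) G) :
    a.inner g (mulInvariantVectorField v g) (mulInvariantVectorField w g) = a.inner 1 v w := by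
  rw [← ha g 1 v w]
  -- The base points `g * 1` and `g` are only propositionally equal; viewing tangent vectors in the
  -- model space avoids a cast.
  have : ∀ h : G, h = g → ∀ u z : EuclideanSpace ℝ (Fin n), a.inner g u z = a.inner h u z := by
    rintro _ rfl _ _; rfl
  exact this _ (mul_one g) _ _

end LieGroup

/-! ### One-parameter subgroups as integral curves. -/

section OneParameterSubgroup

variable {n : ℕ} {G : Type*} [TopologicalSpace G] [ChartedSpace (EuclideanSpace ℝ (Fin n)) G]
  [Group G] [LieGroup (𝓡 n) ∞ G] {φ : OpenPartialHomeomorph G (EuclideanSpace ℝ (Fin n))}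
  {Y : GroupLieAlgebra (𝓡 n) G} {γ : ℝ → G} {t : ℝ}

lemma mfderiv_mul_left_mulInvariantVectorField (g h : G) (v : GroupLieAlgebra (𝓡 n) G) :
    mfderiv (𝓡 n) (𝓡 n) (fun x : G => g * x) h (mulInvariantVectorField v h) =
      mulInvariantVectorField v (g * h) := by
  have e : (fun x : G => g * h * x) = (fun x => g * x) ∘ (fun x => h * x) := by
    ext x; simp [mul_assoc]
  have key : ∀ h' : G, h' = h → mfderiv (𝓡 n) (𝓡 n) (fun x : G => g * x) h =
      mfderiv (𝓡 n) (𝓡 n) (fun x : G => g * x) h' := by rintro _ rfl; rfl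
  rw [key _ (mul_one h)]
  simp only [mulInvariantVectorField]
  rw [e, mfderiv_comp 1 (mdifferentiableAt_mul_left _ _) (mdifferentiableAt_mul_left _ _)]
  rfl

lemma _root_.IsMIntegralCurveOn.mul_left {s : Set ℝ}
    (h : IsMIntegralCurveOn γ (mulInvariantVectorField Y) s) (g : G) :
    IsMIntegralCurveOn (fun t => g * γ t) (mulInvariantVectorField Y) s := by
  intro t ht
  have h1 := (mdifferentiableAt_mul_left g (γ t)).hasMFDerivAt.comp_hasMFDerivWithinAt t (h t ht)
  refine h1.congr_mfderiv (ContinuousLinearMap.ext fun (c : ℝ) => ?_)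
  change mfderiv (𝓡 n) (𝓡 n) (fun x : G => g * x) (γ t) (c • mulInvariantVectorField Y (γ t)) =
    c • mulInvariantVectorField Y (g * γ t)
  rw [map_smul, mfderiv_mul_left_mulInvariantVectorField]

lemma IsOneParameterSubgroup.isMIntegralCurve (h : IsOneParameterSubgroup Y γ) :
    IsMIntegralCurve γ (mulInvariantVectorField Y) := by
  obtain ⟨hsm, h0, hadd, hd⟩ := h
  intro t
  -- Writing γ(s) = γ(t)γ(s - t) transports the velocity at 0 to time t by left translation.
  have e : γ = (fun g => γ t * g) ∘ γ ∘ (fun s => s + -t) := by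
    ext s
    simp [← hadd]
  have h1 : HasMFDerivAt 𝓘(ℝ, ℝ) 𝓘(ℝ, ℝ) (fun s : ℝ => s + -t) t (ContinuousLinearMap.id ℝ ℝ) :=
    ((hasFDerivAt_id t).add_const (-t)).hasMFDerivAt
  have h2 : HasMFDerivAt 𝓘(ℝ, ℝ) (𝓡 n) γ (t + -t) ((1 : ℝ →L[ℝ] ℝ).smulRight Y) := by
    have h3 := (hsm.mdifferentiableAt (x := 0) (by simp)).hasMFDerivAt
    rw [add_neg_cancel]
    refine h3.congr_mfderiv (ContinuousLinearMap.ext fun (c : ℝ) => ?_)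
    have : c = c • (1 : ℝ) := by simp
    rw [this]
    refine (map_smul (mfderiv 𝓘(ℝ, ℝ) (𝓡 n) γ 0) c (1 : ℝ)).trans ?_
    refine (congrArg (fun z : EuclideanSpace ℝ (Fin n) => c • z) hd).trans ?_
    change c • Y = (c • (1 : ℝ)) • Y
    simp
  have h3 : HasMFDerivAt (𝓡 n) (𝓡 n) (fun g => γ t * g) (γ (t + -t))
      (mfderiv (𝓡 n) (𝓡 n) (fun g => γ t * g) 1) := by
    rw [add_neg_cancel, h0]
    exact (mdifferentiableAt_mul_left _ _).hasMFDerivAt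
  have h4 := h3.comp t (h2.comp t h1)
  rw [← e] at h4
  refine h4.congr_mfderiv (ContinuousLinearMap.ext fun (c : ℝ) => ?_)
  exact map_smul (mfderiv (𝓡 n) (𝓡 n) (fun g => γ t * g) 1) c Y

lemma hasDerivAt_coordCurve (hφ : φ ∈ IsManifold.maximalAtlas (𝓡 n) ∞ G)
    (h : IsMIntegralCurve γ (mulInvariantVectorField Y)) (ht : γ t ∈ φ.source) :
    HasDerivAt (coordCurve φ γ) (chartField φ Y (coordCurve φ γ t)) t := by
  have hd := mdifferentiable_of_mem_maximalAtlas hφ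
  have h1 := ((hd.mdifferentiableAt ht).hasMFDerivAt.comp t (h t))
  have h2 : HasFDerivAt (coordCurve φ γ)
      (_ : ℝ →L[ℝ] EuclideanSpace ℝ (Fin n)) t := hasMFDerivAt_iff_hasFDerivAt.mp h1
  refine h2.hasDerivAt.congr_deriv ?_
  have hx : φ (γ t) ∈ φ.target := φ.map_source ht
  refine (isInvertible_mfderiv_symm hφ hx).injective ?_
  refine Eq.trans ?_ (mfderiv_symm_chartField hφ hx Y).symm
  have h3 := congrArg (fun T => T (mulInvariantVectorField Y (γ t))) (hd.symm_comp_deriv ht)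
  have key : ∀ g : G, g = γ t → (mulInvariantVectorField Y g : EuclideanSpace ℝ (Fin n)) =
    mulInvariantVectorField Y (γ t) := by rintro _ rfl; rfl
  refine Eq.trans ?_ (h3.trans (key _ (φ.left_inv ht)).symm)
  change mfderiv (𝓡 n) (𝓡 n) φ.symm (φ (γ t)) (mfderiv (𝓡 n) (𝓡 n) φ (γ t)
    ((1 : ℝ) • mulInvariantVectorField Y (γ t))) = _
  rw [one_smul]
  rfl

/-- In a chart the curve solves an autonomous ODE with smooth right-hand side, so its regularity
bootstraps. -/
lemma contMDiff_of_isMIntegralCurve (h : IsMIntegralCurve γ (mulInvariantVectorField Y)) :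
    ContMDiff 𝓘(ℝ, ℝ) (𝓡 n) ∞ γ := by
  intro t₀
  set φ := chartAt (EuclideanSpace ℝ (Fin n)) (γ t₀)
  have hφ : φ ∈ IsManifold.maximalAtlas (𝓡 n) ∞ G := IsManifold.chart_mem_maximalAtlas _
  have hsrc : ∀ᶠ t in 𝓝 t₀, γ t ∈ φ.source := h.continuous.continuousAt
    (φ.open_source.mem_nhds (mem_chart_source _ _))
  obtain ⟨ε, hε, hball⟩ := Metric.nhds_basis_closedBall.eventually_iff.mp hsrc
  have hc : ContDiffOn ℝ ∞ (coordCurve φ γ) (Set.Icc (t₀ - ε) (t₀ + ε)) := by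
    have hf : ContDiffOn ℝ ((⊤ : ℕ∞) : ℕ∞ω)
        (Function.uncurry fun (_ : ℝ) => chartField φ Y)
        (Set.Icc (t₀ - ε) (t₀ + ε) ×ˢ φ.target) :=
      (contDiffOn_chartField hφ Y).comp contDiff_snd.contDiffOn fun z hz => hz.2
    rw [Real.closedBall_eq_Icc] at hball
    refine ODE.contDiffOn_enat_Icc_of_hasDerivWithinAt hf
      (fun t ht => (hasDerivAt_coordCurve hφ h (hball ht)).hasDerivWithinAt)
      (fun t ht => φ.map_source (hball ht))
  have hc' : ContDiffAt ℝ ∞ (coordCurve φ γ) t₀ :=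
    hc.contDiffAt (Icc_mem_nhds (by linarith) (by linarith))
  have hmem : coordCurve φ γ t₀ ∈ φ.target := φ.map_source (mem_chart_source _ _)
  have h1 := (contMDiffAt_symm_of_mem_maximalAtlas hφ hmem).comp t₀ hc'.contMDiffAt
  refine h1.congr_of_eventuallyEq ?_
  filter_upwards [hsrc] with t ht using (φ.left_inv ht).symm

/-- Left translates of one local integral curve give a lifespan ε uniform in the starting point, so
the field is complete. The homomorphism law is uniqueness applied to t ↦ γ(s + t) and t ↦ γ(s)γ(t).
-/
lemma exists_isOneParameterSubgroup [T2Space G] (Y : GroupLieAlgebra (𝓡 n) G) :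
    ∃ γ : ℝ → G, IsOneParameterSubgroup Y γ := by
  have := isManifold_of_lieGroup n G 1
  have hV : ContMDiff (𝓡 n) (𝓡 n).tangent 1
      (fun g : G => (⟨g, mulInvariantVectorField Y g⟩ : TangentBundle (𝓡 n) G)) :=
    (contMDiff_infty_mulInvariantVectorField Y).of_le (natCast_le_infty 1)
  obtain ⟨γ₀, h0, hγ₀⟩ := exists_isMIntegralCurveAt_of_contMDiffAt_boundaryless (t₀ := 0)
    (hV.contMDiffAt (x := 1))
  obtain ⟨ε, hε, hγ₀⟩ := isMIntegralCurveAt_iff'.mp hγ₀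
  rw [Real.ball_eq_Ioo, zero_sub, zero_add] at hγ₀
  obtain ⟨γ, hγ1, hγ⟩ := exists_isMIntegralCurve_of_isMIntegralCurveOn hV hε
    (fun g => ⟨fun t => g * γ₀ t, by simp [h0], hγ₀.mul_left g⟩) 1
  refine ⟨γ, contMDiff_of_isMIntegralCurve hγ, hγ1, fun s t => ?_, ?_⟩
  · have h1 : IsMIntegralCurve (fun t => γ s * γ t) (mulInvariantVectorField Y) := by
      rw [isMIntegralCurve_iff_isMIntegralCurveOn] at hγ ⊢
      exact hγ.mul_left _
    have h2 := isMIntegralCurve_Ioo_eq_of_contMDiff_boundaryless (t₀ := 0) hV (hγ.comp_add s) h1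
      (by simp [hγ1])
    simpa [add_comm] using congrFun h2 t
  · rw [(hγ 0).mfderiv, hγ1]
    change (1 : ℝ) • mulInvariantVectorField Y (1 : G) = Y
    rw [one_smul]
    have : (fun x : G => 1 * x) = id := by ext; simp
    rw [mulInvariantVectorField, this, mfderiv_id]
    rfl

end OneParameterSubgroup

/-! ### The left invariant frame and its dual. -/

section LeftInvariantFrame

variable {n : ℕ} {G : Type*} [TopologicalSpace G] [ChartedSpace (EuclideanSpace ℝ (Fin n)) G]
  [Group G]

/-- The coordinates with respect to a basis `E` of the Lie algebra. -/
def coords (E : Module.Basis (Fin n) ℝ (GroupLieAlgebra (𝓡 n) G)) :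
    GroupLieAlgebra (𝓡 n) G ≃ₗ[ℝ] EuclideanSpace ℝ (Fin n) :=
  E.equivFun ≪≫ₗ (WithLp.linearEquiv 2 ℝ (Fin n → ℝ)).symm

lemma coords_apply (E : Module.Basis (Fin n) ℝ (GroupLieAlgebra (𝓡 n) G))
    (v : GroupLieAlgebra (𝓡 n) G) (i : Fin n) : coords E v i = E.repr v i := rfl

/-- The left invariant frame with value `E` at the identity, read in the chart `φ`. -/
def frame (φ : OpenPartialHomeomorph G (EuclideanSpace ℝ (Fin n)))
    (E : Module.Basis (Fin n) ℝ (GroupLieAlgebra (𝓡 n) G)) (x : EuclideanSpace ℝ (Fin n)) :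
    EuclideanSpace ℝ (Fin n) →L[ℝ] EuclideanSpace ℝ (Fin n) :=
  ∑ i, (EuclideanSpace.proj i : EuclideanSpace ℝ (Fin n) →L[ℝ] ℝ).smulRight (chartField φ (E i) x)

/-- The dual of the left invariant frame. -/
def coframe (φ : OpenPartialHomeomorph G (EuclideanSpace ℝ (Fin n)))
    (E : Module.Basis (Fin n) ℝ (GroupLieAlgebra (𝓡 n) G)) (x : EuclideanSpace ℝ (Fin n)) :
    EuclideanSpace ℝ (Fin n) →L[ℝ] EuclideanSpace ℝ (Fin n) :=
  (frame φ E x).inverse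

lemma frame_coords (φ : OpenPartialHomeomorph G (EuclideanSpace ℝ (Fin n)))
    (E : Module.Basis (Fin n) ℝ (GroupLieAlgebra (𝓡 n) G)) (x : EuclideanSpace ℝ (Fin n))
    (v : GroupLieAlgebra (𝓡 n) G) : frame φ E x (coords E v) = chartField φ v x := by
  let T : GroupLieAlgebra (𝓡 n) G →ₗ[ℝ] EuclideanSpace ℝ (Fin n) :=
    { toFun := fun v => chartField φ v x
      map_add' := fun v w => congrFun (chartField_add φ v w) x
      map_smul' := fun c v => congrFun (chartField_smul φ c v) x }
  have h : T v = ∑ i, E.repr v i • T (E i) := by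
    conv_lhs => rw [← E.sum_repr v]
    rw [map_sum]
    simp only [map_smul]
  change _ = T v
  rw [h]
  simp [frame, coords_apply, T]

variable [LieGroup (𝓡 n) ∞ G] {φ : OpenPartialHomeomorph G (EuclideanSpace ℝ (Fin n))}
  {x : EuclideanSpace ℝ (Fin n)} (E : Module.Basis (Fin n) ℝ (GroupLieAlgebra (𝓡 n) G))

lemma isInvertible_frame (hφ : φ ∈ IsManifold.maximalAtlas (𝓡 n) ∞ G) (hx : x ∈ φ.target) :
    (frame φ E x).IsInvertible := by
  have hinj : Function.Injective (frame φ E x) := by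
    intro u w h
    rw [← (coords E).apply_symm_apply u, ← (coords E).apply_symm_apply w, frame_coords,
      frame_coords] at h
    apply (coords E).symm.injective
    apply mulInvariantVectorField_injective (φ.symm x)
    change mulInvariantVectorField _ _ = mulInvariantVectorField _ _
    rw [← mfderiv_symm_chartField hφ hx, ← mfderiv_symm_chartField hφ hx, h]
  exact ⟨(LinearEquiv.ofInjectiveEndo (frame φ E x).toLinearMap hinj).toContinuousLinearEquiv, rfl⟩

lemma coframe_chartField (hφ : φ ∈ IsManifold.maximalAtlas (𝓡 n) ∞ G) (hx : x ∈ φ.target)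
    (v : GroupLieAlgebra (𝓡 n) G) : coframe φ E x (chartField φ v x) = coords E v := by
  rw [← frame_coords φ E, coframe, (isInvertible_frame E hφ hx).inverse_apply_self]

lemma chartField_coframe (hφ : φ ∈ IsManifold.maximalAtlas (𝓡 n) ∞ G) (hx : x ∈ φ.target)
    (y : EuclideanSpace ℝ (Fin n)) :
    chartField φ ((coords E).symm (coframe φ E x y)) x = y := by
  rw [← frame_coords φ E, LinearEquiv.apply_symm_apply, coframe,
    (isInvertible_frame E hφ hx).self_apply_inverse]

lemma coframe_injective (hφ : φ ∈ IsManifold.maximalAtlas (𝓡 n) ∞ G) (hx : x ∈ φ.target) :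
    Function.Injective (coframe φ E x) :=
  (isInvertible_frame E hφ hx).inverse.injective

lemma differentiableAt_coframe (hφ : φ ∈ IsManifold.maximalAtlas (𝓡 n) ∞ G) (hx : x ∈ φ.target) :
    DifferentiableAt ℝ (coframe φ E) x := by
  have h1 : DifferentiableAt ℝ (frame φ E) x := by
    unfold frame
    refine DifferentiableAt.fun_sum fun i _ => ?_
    exact ((ContinuousLinearMap.smulRightL ℝ _ _
      (EuclideanSpace.proj i : EuclideanSpace ℝ (Fin n) →L[ℝ] ℝ)).differentiableAt).comp x
      (differentiableAt_chartField hφ hx (E i))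
  obtain ⟨e, he⟩ := isInvertible_frame E hφ hx
  have h2 := (contDiffAt_map_inverse (𝕜 := ℝ) (n := 1) e).differentiableAt one_ne_zero
  rw [he] at h2
  exact h2.comp x h1

/-- Differentiate the pairing of the coframe with a left invariant field, which is constant. -/
lemma fderiv_coframe_chartField (hφ : φ ∈ IsManifold.maximalAtlas (𝓡 n) ∞ G) (hx : x ∈ φ.target)
    (w : GroupLieAlgebra (𝓡 n) G) (h : EuclideanSpace ℝ (Fin n)) :
    fderiv ℝ (coframe φ E) x h (chartField φ w x) =
      -coframe φ E x (fderiv ℝ (chartField φ w) x h) := by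
  have h1 := (differentiableAt_coframe E hφ hx).hasFDerivAt.clm_apply
    (differentiableAt_chartField hφ hx w).hasFDerivAt
  have h2 : (fun z => coframe φ E z (chartField φ w z)) =ᶠ[𝓝 x] fun _ => coords E w := by
    filter_upwards [φ.open_target.mem_nhds hx] with z hz using coframe_chartField E hφ hz w
  have h3 := congrArg (fun T => T h) (h1.fderiv.symm.trans h2.fderiv_eq)
  simp at h3
  rw [eq_neg_iff_add_eq_zero, add_comm]
  exact h3

/-- The Maurer–Cartan equation. -/
lemma maurerCartan (hφ : φ ∈ IsManifold.maximalAtlas (𝓡 n) ∞ G) (hx : x ∈ φ.target)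
    (v w : GroupLieAlgebra (𝓡 n) G) :
    fderiv ℝ (coframe φ E) x (chartField φ v x) (chartField φ w x) -
      fderiv ℝ (coframe φ E) x (chartField φ w x) (chartField φ v x) = -coords E ⁅v, w⁆ := by
  rw [fderiv_coframe_chartField E hφ hx, fderiv_coframe_chartField E hφ hx,
    ← coframe_chartField E hφ hx ⁅v, w⁆, ← lieBracket_chartField hφ hx, map_sub]
  abel

/-! ### Left invariant Randers metrics in the frame. -/

variable {a : Metric n G} {E} {X : GroupLieAlgebra (𝓡 n) G}

lemma inner_one_eq_inner_coords (hon : ∀ i j, a.inner 1 (E i) (E j) = if i = j then 1 else 0)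
    (v w : GroupLieAlgebra (𝓡 n) G) : a.inner 1 v w = inner ℝ (coords E v) (coords E w) := by
  conv_lhs => rw [← E.sum_repr v, ← E.sum_repr w]
  simp only [map_sum, map_smul, sum_apply, smul_apply, hon, PiLp.inner_apply, coords_apply]
  simp [mul_comm]

lemma localSq_randers (ha : IsLeftInvariant a)
    (hon : ∀ i j, a.inner 1 (E i) (E j) = if i = j then 1 else 0)
    (hφ : φ ∈ IsManifold.maximalAtlas (𝓡 n) ∞ G) (hx : x ∈ φ.target)
    (y : EuclideanSpace ℝ (Fin n)) :
    localSq (randers a X) φ x y = randersNorm (coords E X) (coframe φ E x y) ^ 2 := by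
  set v := (coords E).symm (coframe φ E x y) with hv
  have hy : mfderiv (𝓡 n) (𝓡 n) φ.symm x y = mulInvariantVectorField v (φ.symm x) := by
    rw [← mfderiv_symm_chartField hφ hx, chartField_coframe E hφ hx]
  rw [localSq, hy, randers, inner_mulInvariantVectorField ha, inner_mulInvariantVectorField ha,
    inner_one_eq_inner_coords hon, inner_one_eq_inner_coords hon, hv,
    LinearEquiv.apply_symm_apply, real_inner_self_eq_norm_sq, Real.sqrt_sq (norm_nonneg _),
    randersNorm]

lemma norm_coords_lt_one (hon : ∀ i j, a.inner 1 (E i) (E j) = if i = j then 1 else 0)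
    (hX : a.inner 1 X X < 1) : ‖coords E X‖ < 1 := by
  rw [inner_one_eq_inner_coords hon, real_inner_self_eq_norm_sq] at hX
  exact (sq_lt_one_iff₀ (norm_nonneg _)).mp hX

/-- The spray of a left invariant Randers metric along left invariant vector fields. -/
lemma sprayCoeff_randers (ha : IsLeftInvariant a)
    (hon : ∀ i j, a.inner 1 (E i) (E j) = if i = j then 1 else 0) (hX : a.inner 1 X X < 1)
    (hφ : φ ∈ IsManifold.maximalAtlas (𝓡 n) ∞ G) (hx : x ∈ φ.target)
    {v : GroupLieAlgebra (𝓡 n) G} (hv : v ≠ 0) (w : GroupLieAlgebra (𝓡 n) G) :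
    fderiv ℝ (randersSqDeriv (coords E X)) (coords E v)
      (coframe φ E x ((2 : ℝ) • WithLp.toLp 2
        (sprayCoeff (localSq (randers a X) φ) x (chartField φ v x))) -
        fderiv ℝ (coframe φ E) x (chartField φ v x) (chartField φ v x)) (coords E w) =
      -randersSqDeriv (coords E X) (coords E v) (coords E ⁅v, w⁆) := by
  have hv' : chartField φ v x ≠ 0 := by
    intro h
    have := coframe_chartField E hφ hx v
    rw [h, map_zero] at this
    exact hv ((coords E).map_eq_zero_iff.mp this.symm)
  have h := sprayCoeff_of_frame (L := localSq (randers a X) φ) (norm_coords_lt_one hon hX)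
    (Filter.Eventually.mono (φ.open_target.mem_nhds hx) fun z hz y =>
      localSq_randers ha hon hφ hz y)
    (differentiableAt_coframe E hφ hx) (coframe_injective E hφ hx) hv' (chartField φ w x)
  rwa [maurerCartan E hφ hx, coframe_chartField E hφ hx, coframe_chartField E hφ hx, map_neg] at h

/-- The Hessian of N² pairs the coframe image of c'' + 2G(c, c') with w to give -d(N²)_Y([Y, w]).
Nondegeneracy of the Hessian and N(Y) > 0 turn this into an equivalence. -/
lemma isGeodesicVector_randers_iff [T2Space G] (ha : IsLeftInvariant a)
    (hon : ∀ i j, a.inner 1 (E i) (E j) = if i = j then 1 else 0) (hX : a.inner 1 X X < 1)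
    {Y : GroupLieAlgebra (𝓡 n) G} (hY : Y ≠ 0) :
    IsGeodesicVector (randers a X) Y ↔
      ∀ w, randersNormDeriv (coords E X) (coords E Y) (coords E ⁅Y, w⁆) = 0 := by
  have hξ := norm_coords_lt_one hon hX
  have hu : coords E Y ≠ 0 := by simpa using hY
  have key : ∀ γ : ℝ → G, IsOneParameterSubgroup Y γ →
      ∀ φ ∈ IsManifold.maximalAtlas (𝓡 n) ∞ G, ∀ t : ℝ, γ t ∈ φ.source →
      deriv (coordCurve φ γ) t = chartField φ Y (φ (γ t)) ∧
      ∀ w, fderiv ℝ (randersSqDeriv (coords E X)) (coords E Y)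
        (coframe φ E (φ (γ t)) (deriv (deriv (coordCurve φ γ)) t + (2 : ℝ) • WithLp.toLp 2
          (sprayCoeff (localSq (randers a X) φ) (φ (γ t)) (deriv (coordCurve φ γ) t))))
        (coords E w) = -randersSqDeriv (coords E X) (coords E Y) (coords E ⁅Y, w⁆) := by
    intro γ hγ φ hφ t ht
    have hc := hγ.isMIntegralCurve
    have hx : φ (γ t) ∈ φ.target := φ.map_source ht
    have h1 : deriv (coordCurve φ γ) t = chartField φ Y (φ (γ t)) :=
      (hasDerivAt_coordCurve hφ hc ht).deriv
    have h2 : deriv (coordCurve φ γ) =ᶠ[𝓝 t] fun s => chartField φ Y (coordCurve φ γ s) := by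
      filter_upwards [hc.continuous.continuousAt (φ.open_source.mem_nhds ht)] with s hs
      exact (hasDerivAt_coordCurve hφ hc hs).deriv
    have h3 : deriv (deriv (coordCurve φ γ)) t =
        fderiv ℝ (chartField φ Y) (φ (γ t)) (chartField φ Y (φ (γ t))) := by
      rw [h2.deriv_eq]
      exact ((differentiableAt_chartField hφ hx Y).hasFDerivAt.comp_hasDerivAt t
        (hasDerivAt_coordCurve hφ hc ht)).deriv
    refine ⟨h1, fun w => ?_⟩
    rw [← sprayCoeff_randers ha hon hX hφ hx hY w, fderiv_coframe_chartField E hφ hx, h3, h1,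
      map_add, sub_neg_eq_add, add_comm]
  constructor
  · rintro ⟨-, γ, hγ, -, hgeo⟩ w
    set φ := chartAt (EuclideanSpace ℝ (Fin n)) (γ 0)
    have hφ : φ ∈ IsManifold.maximalAtlas (𝓡 n) ∞ G := IsManifold.chart_mem_maximalAtlas _
    have ht : γ 0 ∈ φ.source := mem_chart_source _ _
    have h1 := (key γ hγ φ hφ 0 ht).2 w
    have h2 : deriv (deriv (coordCurve φ γ)) 0 + (2 : ℝ) • WithLp.toLp 2
        (sprayCoeff (localSq (randers a X) φ) (φ (γ 0)) (deriv (coordCurve φ γ) 0)) = 0 := by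
      ext i
      simpa using (hgeo φ hφ 0 ht).2 i
    rw [h2, map_zero, map_zero, zero_apply, eq_comm, neg_eq_zero,
      randersSqDeriv_apply] at h1
    exact (mul_eq_zero.mp h1).resolve_left (by have := randersNorm_pos hξ hu; positivity)
  · intro h
    obtain ⟨γ, hγ⟩ := exists_isOneParameterSubgroup Y
    refine ⟨hY, γ, hγ, hγ.1, fun φ hφ t ht => ?_⟩
    have hx : φ (γ t) ∈ φ.target := φ.map_source ht
    obtain ⟨h1, h2⟩ := key γ hγ φ hφ t ht
    constructor
    · intro h0
      rw [h1] at h0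
      have := coframe_chartField E hφ hx Y
      rw [h0, map_zero] at this
      exact hu this.symm
    · set Z := deriv (deriv (coordCurve φ γ)) t + (2 : ℝ) • WithLp.toLp 2
        (sprayCoeff (localSq (randers a X) φ) (φ (γ t)) (deriv (coordCurve φ γ) t))
      have h3 : coframe φ E (φ (γ t)) Z = 0 := by
        -- Testing with w equal to the coframe image of `Z` itself lets positive definiteness apply.
        refine eq_zero_of_fderiv_randersSqDeriv_self_eq_zero hξ hu ?_
        have := h2 ((coords E).symm (coframe φ E (φ (γ t)) Z))
        rw [LinearEquiv.apply_symm_apply] at this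
        rw [this, randersSqDeriv_apply, h, mul_zero, neg_zero]
      have h4 : Z = 0 := coframe_injective E hφ hx (by rw [h3, map_zero])
      intro i
      simpa [Z] using congrArg (fun z : EuclideanSpace ℝ (Fin n) => z i) h4

/-- The vector field of a left invariant Randers metric of Douglas type is orthogonal to the
derived algebra. -/
lemma inner_coords_lie_eq_zero_of_isDouglas (ha : IsLeftInvariant a)
    (hon : ∀ i j, a.inner 1 (E i) (E j) = if i = j then 1 else 0) (hX : a.inner 1 X X < 1)
    (hF : IsDouglas (randers a X)) (v w : GroupLieAlgebra (𝓡 n) G) :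
    inner ℝ (coords E X) (coords E ⁅v, w⁆) = 0 := by
  have := lieGroup_minSmoothness_three n G
  set φ := chartAt (EuclideanSpace ℝ (Fin n)) (1 : G)
  have hφ : φ ∈ IsManifold.maximalAtlas (𝓡 n) ∞ G := IsManifold.chart_mem_maximalAtlas _
  have hx : φ 1 ∈ φ.target := φ.map_source (mem_chart_source _ _)
  set x := φ 1
  rcases eq_or_ne v 0 with rfl | hv
  · rw [show ⁅(0 : GroupLieAlgebra (𝓡 n) G), w⁆ = 0 from zero_lie w]
    simp
  obtain ⟨Γ, P, -, hΓ⟩ := hF φ hφ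
  set q : EuclideanSpace ℝ (Fin n) → EuclideanSpace ℝ (Fin n) := fun y =>
    WithLp.toLp 2 fun i => ∑ j, ∑ k, Γ x i j k * y j * y k with hq
  have hqneg : ∀ y, q (-y) = q y := fun y => by simp [hq]
  have hG : ∀ y, y ≠ 0 → (2 : ℝ) • WithLp.toLp 2 (sprayCoeff (localSq (randers a X) φ) x y) =
      q y + (2 * P x y) • y := by
    intro y hy
    ext i
    simp [hΓ x hx y hy i, hq]
    ring
  -- Here the torsion is minus the bracket. `Q` is even because `q` and the derivative term are both
  -- quadratic in the velocity, and P enters only through the radial coefficient `μ`.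
  have h := inner_torsion_eq_zero (norm_coords_lt_one hon hX)
    (C := fun u w => -coords E ⁅(coords E).symm u, (coords E).symm w⁆)
    (Q := fun u => coframe φ E x (q (frame φ E x u)) -
      fderiv ℝ (coframe φ E) x (frame φ E x u) (frame φ E x u))
    (μ := fun u => 2 * P x (frame φ E x u))
    (fun u => by
      rw [show ⁅(coords E).symm u, (coords E).symm u⁆ = 0 from lie_self _]; simp)
    (fun u w => by
      rw [map_neg]
      rw [show ⁅-(coords E).symm u, (coords E).symm w⁆ = -⁅(coords E).symm u, (coords E).symm w⁆
        from neg_lie _ _]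
      rw [map_neg])
    (fun u => by simp [hqneg])
    (fun u hu w => by
      have hu' : (coords E).symm u ≠ 0 := by simpa using hu
      have h1 := sprayCoeff_randers ha hon hX hφ hx hu' ((coords E).symm w)
      have h2 : frame φ E x u = chartField φ ((coords E).symm u) x := by
        rw [← frame_coords φ E, LinearEquiv.apply_symm_apply]
      have h3 : coframe φ E x (frame φ E x u) = u := by
        rw [h2, coframe_chartField E hφ hx, LinearEquiv.apply_symm_apply]
      have h4 : frame φ E x u ≠ 0 := by
        intro h; rw [h, map_zero] at h3; exact hu h3.symm
      rw [← h2, hG _ h4, map_add, map_smul, h3, LinearEquiv.apply_symm_apply,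
        LinearEquiv.apply_symm_apply] at h1
      rw [map_neg, ← h1]
      congr 2
      abel)
    (u := coords E v) (by simpa using hv) (coords E w)
  simpa using h

end LeftInvariantFrame

/-! ### Algebra of 𝔩₅,₉. -/

section L59

variable {𝔤 : Type*} [LieRing 𝔤] [LieAlgebra ℝ 𝔤] {k l m p q : ℝ} {E : Module.Basis (Fin 5) ℝ 𝔤}

lemma IsL59Basis.lie_combination (hE : IsL59Basis k l m p q E) (y₁ y₂ y₃ y₄ y₅ : ℝ) :
    let Y := y₁ • E 0 + y₂ • E 1 + y₃ • E 2 + y₄ • E 3 + y₅ • E 4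
    ⁅Y, E 0⁆ = -(y₂ • (k • E 2 + l • E 3 + m • E 4)) - y₃ • p • E 3 ∧
    ⁅Y, E 1⁆ = y₁ • (k • E 2 + l • E 3 + m • E 4) - y₃ • q • E 4 ∧
    ⁅Y, E 2⁆ = y₁ • p • E 3 + y₂ • q • E 4 ∧ ⁅Y, E 3⁆ = 0 ∧ ⁅Y, E 4⁆ = 0 := by
  have h10 := (lie_skew (E 1) (E 0)).symm
  have h20 := (lie_skew (E 2) (E 0)).symm
  have h21 := (lie_skew (E 2) (E 1)).symm
  have h30 := (lie_skew (E 3) (E 0)).symm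
  have h31 := (lie_skew (E 3) (E 1)).symm
  have h32 := (lie_skew (E 3) (E 2)).symm
  have h40 := (lie_skew (E 4) (E 0)).symm
  have h41 := (lie_skew (E 4) (E 1)).symm
  have h42 := (lie_skew (E 4) (E 2)).symm
  have h43 := (lie_skew (E 4) (E 3)).symm
  rw [hE.b12] at h10
  rw [hE.b13] at h20
  rw [hE.b23] at h21
  rw [hE.b14, neg_zero] at h30
  rw [hE.b24, neg_zero] at h31
  rw [hE.b34, neg_zero] at h32
  rw [hE.b15, neg_zero] at h40
  rw [hE.b25, neg_zero] at h41
  rw [hE.b35, neg_zero] at h42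
  rw [hE.b45, neg_zero] at h43
  simp only [add_lie, smul_lie, lie_self, hE.b12, hE.b13, hE.b14, hE.b15, hE.b23, hE.b24, hE.b25,
    hE.b34, hE.b35, hE.b45, h10, h20, h21, h30, h31, h32, h40, h41, h42, h43, smul_zero, add_zero,
    zero_add, smul_neg, sub_eq_add_neg, and_self]

/-- The Riemannian geodesic vectors of a metric Lie algebra `𝔩₅,₉`. -/
lemma IsL59Basis.forall_lie_eq_zero_iff (hE : IsL59Basis k l m p q E) {B : 𝔤 →ₗ[ℝ] 𝔤 →ₗ[ℝ] ℝ}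
    (hB : ∀ i j, B (E i) (E j) = if i = j then 1 else 0) {Y : 𝔤} {y₁ y₂ y₃ y₄ y₅ : ℝ}
    (hY : Y = y₁ • E 0 + y₂ • E 1 + y₃ • E 2 + y₄ • E 3 + y₅ • E 4) :
    (∀ w, B Y ⁅Y, w⁆ = 0) ↔
      y₂ * (k * y₃ + l * y₄ + m * y₅) + p * y₃ * y₄ = 0 ∧
      y₁ * (k * y₃ + l * y₄ + m * y₅) - q * y₃ * y₅ = 0 ∧
      p * y₁ * y₄ + q * y₂ * y₅ = 0 := by
  obtain ⟨h0, h1, h2, h3, h4⟩ := hE.lie_combination y₁ y₂ y₃ y₄ y₅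
  rw [← hY] at h0 h1 h2 h3 h4
  have e0 : B Y ⁅Y, E 0⁆ = -(y₂ * (k * y₃ + l * y₄ + m * y₅) + p * y₃ * y₄) := by
    rw [h0]; simp [hY, hB]; ring
  have e1 : B Y ⁅Y, E 1⁆ = y₁ * (k * y₃ + l * y₄ + m * y₅) - q * y₃ * y₅ := by
    rw [h1]; simp [hY, hB]; ring
  have e2 : B Y ⁅Y, E 2⁆ = p * y₁ * y₄ + q * y₂ * y₅ := by
    rw [h2]; simp [hY, hB]; ring
  constructor
  · intro h
    exact ⟨by rw [← neg_eq_zero, ← e0]; exact h _, by rw [← e1]; exact h _,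
      by rw [← e2]; exact h _⟩
  · rintro ⟨g0, g1, g2⟩ w
    rw [← E.sum_repr w, Fin.sum_univ_five]
    simp only [lie_add, lie_smul, map_add, map_smul, e0, e1, e2, g0, g1, g2]
    rw [h3, h4]
    simp

lemma Basis.repr_fin_five {V : Type*} [AddCommGroup V] [Module ℝ V] (E : Module.Basis (Fin 5) ℝ V)
    (y₁ y₂ y₃ y₄ y₅ : ℝ) :
    let r := E.repr (y₁ • E 0 + y₂ • E 1 + y₃ • E 2 + y₄ • E 3 + y₅ • E 4)
    r 0 = y₁ ∧ r 1 = y₂ ∧ r 2 = y₃ ∧ r 3 = y₄ ∧ r 4 = y₅ := by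
  simp

lemma geodesic_equations_iff {V : Type*} [AddCommGroup V] [Module ℝ V]
    (E : Module.Basis (Fin 5) ℝ V) (hq : 0 < q) {Y : V} {y₁ y₂ y₃ y₄ y₅ : ℝ}
    (hY : Y = y₁ • E 0 + y₂ • E 1 + y₃ • E 2 + y₄ • E 3 + y₅ • E 4) :
    (y₂ * (k * y₃ + l * y₄ + m * y₅) + p * y₃ * y₄ = 0 ∧
      y₁ * (k * y₃ + l * y₄ + m * y₅) - q * y₃ * y₅ = 0 ∧
      p * y₁ * y₄ + q * y₂ * y₅ = 0) ↔
    (Y ∈ Submodule.span ℝ {E 2} ∨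
      Y ∈ Submodule.span ℝ {E 3, E 4} ∨
      (Y ∈ Submodule.span ℝ {E 1, E 2, E 3} ∧ y₂ * (k * y₃ + l * y₄) + p * y₃ * y₄ = 0) ∨
      (y₁ ≠ 0 ∧ y₁ * (k * y₃ + l * y₄ + m * y₅) - q * y₃ * y₅ = 0 ∧
        p * y₁ * y₄ + q * y₂ * y₅ = 0)) := by
  obtain ⟨r0, r1, r2, r3, r4⟩ := Basis.repr_fin_five E y₁ y₂ y₃ y₄ y₅
  rw [← hY] at r0 r1 r2 r3 r4
  constructor
  · rintro ⟨g0, g1, g2⟩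
    rcases eq_or_ne y₁ 0 with rfl | h1
    · have h35 : y₃ * y₅ = 0 := by
        have : q * (y₃ * y₅) = 0 := by linarith
        exact (mul_eq_zero.mp this).resolve_left hq.ne'
      have h25 : y₂ * y₅ = 0 := by
        have : q * (y₂ * y₅) = 0 := by linarith
        exact (mul_eq_zero.mp this).resolve_left hq.ne'
      rcases eq_or_ne y₅ 0 with rfl | h5
      · refine Or.inr (Or.inr (Or.inl ⟨?_, by linarith⟩))
        exact Submodule.mem_span_triple.mpr ⟨y₂, y₃, y₄, by simp [hY]⟩
      · obtain rfl := (mul_eq_zero.mp h35).resolve_right h5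
        obtain rfl := (mul_eq_zero.mp h25).resolve_right h5
        exact Or.inr (Or.inl (Submodule.mem_span_pair.mpr ⟨y₄, y₅, by simp [hY]⟩))
    · exact Or.inr (Or.inr (Or.inr ⟨h1, g1, g2⟩))
  · rintro (h | h | ⟨h, g⟩ | ⟨h1, g1, g2⟩)
    · obtain ⟨c, rfl⟩ := Submodule.mem_span_singleton.mp h
      simp at r0 r1 r3 r4
      simp [← r0, ← r1, ← r3, ← r4]
    · obtain ⟨b, c, rfl⟩ := Submodule.mem_span_pair.mp h
      simp at r0 r1 r2
      simp [← r0, ← r1, ← r2]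
    · obtain ⟨b, c, d, rfl⟩ := Submodule.mem_span_triple.mp h
      simp at r0 r4
      simp only [← r0, ← r4]
      refine ⟨by linarith, by ring, by ring⟩
    · refine ⟨?_, g1, g2⟩
      -- ⟪Y, [Y, Y]⟫ = 0 expresses y₁ times the first equation through the other two.
      refine (mul_eq_zero.mp (?_ : y₁ * _ = 0)).resolve_left h1
      linear_combination y₂ * g1 + y₃ * g2

end L59

end LieFinsler

theorem mainTheorem11
    {G : Type*} [TopologicalSpace G] [T2Space G] [ChartedSpace (EuclideanSpace ℝ (Fin 5)) G]
    [Group G] [LieGroup (𝓡 5) ∞ G]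
    (a : LieFinsler.Metric 5 G) (ha : LieFinsler.IsLeftInvariant a)
    (k l m p q : ℝ) (E : Module.Basis (Fin 5) ℝ (GroupLieAlgebra (𝓡 5) G))
    (hE : LieFinsler.IsL59Basis k l m p q E)
    (hon : ∀ i j, a.inner 1 (E i) (E j) = if i = j then 1 else 0)
    (X : GroupLieAlgebra (𝓡 5) G) (hX : a.inner 1 X X < 1)
    (hF : LieFinsler.IsDouglas (LieFinsler.randers a X))
    (y₁ y₂ y₃ y₄ y₅ : ℝ) (Y : GroupLieAlgebra (𝓡 5) G)
    (hY : Y = y₁ • E 0 + y₂ • E 1 + y₃ • E 2 + y₄ • E 3 + y₅ • E 4) (hY0 : Y ≠ 0) :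
    LieFinsler.IsGeodesicVector (LieFinsler.randers a X) Y ↔
      Y ∈ Submodule.span ℝ {E 2} ∨
      Y ∈ Submodule.span ℝ {E 3, E 4} ∨
      (Y ∈ Submodule.span ℝ {E 1, E 2, E 3} ∧ y₂ * (k * y₃ + l * y₄) + p * y₃ * y₄ = 0) ∨
      (a.inner 1 Y (E 0) ≠ 0 ∧
        y₁ * (k * y₃ + l * y₄ + m * y₅) - q * y₃ * y₅ = 0 ∧
        p * y₁ * y₄ + q * y₂ * y₅ = 0) := by
  have := LieFinsler.lieGroup_minSmoothness_three 5 G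
  have hq : 0 < q := by
    rcases hE.params with ⟨-, h1, h2, -⟩ | ⟨-, h1, -, -, rfl⟩
    · exact h2.trans h1
    · exact h1
  let B : GroupLieAlgebra (𝓡 5) G →ₗ[ℝ] GroupLieAlgebra (𝓡 5) G →ₗ[ℝ] ℝ :=
    (a.inner 1).toLinearMap₁₂
  have h0 : a.inner 1 Y (E 0) = y₁ := by
    rw [hY]
    simp [hon]
  rw [LieFinsler.isGeodesicVector_randers_iff ha hon hX hY0, h0,
    ← LieFinsler.geodesic_equations_iff E hq hY,
    ← LieFinsler.IsL59Basis.forall_lie_eq_zero_iff (E := E) (B := B) hE hon hY]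
  refine forall_congr' fun w => ?_
  -- X is orthogonal to [Y, w], so only ‖Y‖⁻¹⟪Y, [Y, w]⟫ survives: the Riemannian condition.
  rw [LieFinsler.randersNormDeriv_apply,
    LieFinsler.inner_coords_lie_eq_zero_of_isDouglas ha hon hX hF, add_zero,
    ← LieFinsler.inner_one_eq_inner_coords hon, mul_eq_zero, inv_eq_zero, norm_eq_zero]
  simp only [LinearEquiv.map_eq_zero_iff, hY0, false_or]
  rfl

end
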